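/- Fix $\beta>0$. On a probability space, for each $n\ge 1$ let $Z^{(n)}_1,\dots,Z^{(n)}_n$ be complex random variables (with an arbitrary joint law), and let $\gamma^{(n)}_1,\dots,\gamma^{(n)}_n$ be i.i.d. random variables with the Gamma distribution of parameter $\beta/2$ (density $\Gamma(\beta/2)^{-1}t^{\beta/2-1}e^{-t}$ on $(0,\infty)$), the family $(\gamma^{(n)}_k)_{1\le k\le n}$ being independent of the family $(Z^{(n)}_k)_{1\le k\le n}$. Let $$\mu_n=\frac1n\sum_{k=1}^n\delta_{Z^{(n)}_k},\qquad P_n(z)=\prod_{k=1}^n\bigl(z-Z^{(n)}_k\bigr),$$ and let $V_n$ be the polynomial $$V_n(z)=P_n(z)\sum_{k=1}^n\gamma^{(n)}_k\,\frac{Z^{(n)}_k+z}{Z^{(n)}_k-z}=-\sum_{k=1}^n\gamma^{(n)}_k\bigl(Z^{(n)}_k+z\bigr)\prod_{l\ne k}\bigl(z-Z^{(n)}_l\bigr),$$ which almost surely has degree $n$. For $n\ge2$ let $\tilde\nu_n$ be the empirical measure of the zeros of $V_n$ in $\mathbb C$, counted with multiplicity. If, almost surely, $\mu_n$ converges weakly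 to a deterministic finite measure $\mu$ on $\mathbb C$ (necessarily a probability measure), then, almost surely, $\tilde\nu_n$ converges weakly to $\mu$. -/

import Mathlib

open MeasureTheory ProbabilityTheory Filter Topology
open scoped NNReal

/-- The empirical measure of a finite collection of complex numbers, each point being counted
with its multiplicity: `(1 / N) ∑ δ_z`, where `N` is the number of points. -/
noncomputable def empiricalMeasure (s : Multiset ℂ) : FiniteMeasure ℂ :=
  ((Multiset.card s : ℝ≥0)⁻¹) • (s.map fun z => (diracProba z).toFiniteMeasure).sum

/-- The monic polynomial `∏ (X - Z_j)` with zeros `Z_1, …, Z_n`. -/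
noncomputable def zeroPolynomial {n : ℕ} (Z : Fin n → ℂ) : Polynomial ℂ :=
  ∏ j, (Polynomial.X - Polynomial.C (Z j))

/-- The circular variant of the randomized derivative of `P = ∏ (X - Z_j)`, with weights `γ_k`:
the polynomial given by `P(z) ∑ γ_k (Z_k + z) / (Z_k - z)`. Since
`P(z) / (Z_k - z) = -∏_{l ≠ k} (z - Z_l)`, it is
`-∑ γ_k (Z_k + X) ∏_{l ≠ k} (X - Z_l)`; see `circularDerivative_eval`. -/
noncomputable def circularDerivative {n : ℕ} (Z : Fin n → ℂ) (γ : Fin n → ℝ) : Polynomial ℂ :=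
  -∑ k, Polynomial.C (γ k : ℂ) * (Polynomial.C (Z k) + Polynomial.X) *
    ∏ l ∈ Finset.univ.erase k, (Polynomial.X - Polynomial.C (Z l))

/-- Off the points `Z_k`, the circular derivative is `P(z) ∑ γ_k (Z_k + z) / (Z_k - z)`. -/
theorem circularDerivative_eval {n : ℕ} (Z : Fin n → ℂ) (γ : Fin n → ℝ) (z : ℂ)
    (hz : ∀ k, z ≠ Z k) :
    (circularDerivative Z γ).eval z =
      (zeroPolynomial Z).eval z * ∑ k, (Z k + z) / (Z k - z) * (γ k : ℂ) := by
  simp only [circularDerivative, zeroPolynomial, Polynomial.eval_neg, Polynomial.eval_finsetSum,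
    Polynomial.eval_mul, Polynomial.eval_prod, Polynomial.eval_add, Polynomial.eval_sub,
    Polynomial.eval_C, Polynomial.eval_X]
  rw [Finset.mul_sum, ← Finset.sum_neg_distrib]
  refine Finset.sum_congr rfl fun k _ => ?_
  rw [← Finset.mul_prod_erase Finset.univ (fun l => z - Z l) (Finset.mem_univ k)]
  have h : Z k - z ≠ 0 := sub_ne_zero.mpr (hz k).symm
  field_simp
  ring

/-! The zero measure of a polynomial `p` is, up to a constant, the distributional Laplacian of `log
|p|`. Two polynomials of degree `n` therefore have asymptotically equal empirical zero measures as
soon as the logarithms of their moduli differ by `o(n)` in `L¹` on every disc. Here that difference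
is `log |S_n(z)|` with `S_n(z) = ∑ γ_k (Z_k + z) / (Z_k - z)`, so no information on the joint law of
the `Z_k` is needed.

Deterministic half: no Laplacian is taken. By Jensen's formula, the difference of the circle
averages of `log |p|` over radii `2r` and `r` about `a` is a sum of tents `logTent r (a - w)` over
the roots `w`. Normalised tents are an approximate identity, which gives
`exists_enorm_sum_roots_sub_sum_roots_le`; conservation of mass upgrades vague to weak convergence.

Probabilistic half: `|log x|³` is dominated by `|x|^s + |x|^(-s)` for a small `s`. The positive
moment of `S_n(z)` is at most linear in `n` by subadditivity of `t ↦ t^s`. The negative moment is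
bounded by freezing all weights but one: the gamma law has negative moments that are uniform under
translation. Integrating over a disc, the third moment of `log |S_n|` is `O(n)` uniformly in the
`Z_k`. Dividing by `n³` gives a summable series, hence almost sure convergence with no assumption
relating different `n`. -/

open scoped ENNReal
open Real (circleAverage posLog)

/-! ### Jensen's formula and the tent kernel -/

/-- The difference of the averages of `log ‖· - w‖` over the circles of radii `2 * r` and `r` around
`a`, as a function of `u = a - w`: a tent supported in the ball of radius `2 * r`. -/
noncomputable def logTent (r : ℝ) (u : ℂ) : ℝ :=
  Real.log 2 + posLog ((2 * r)⁻¹ * ‖u‖) - posLog (r⁻¹ * ‖u‖)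

theorem continuous_logTent (r : ℝ) : Continuous (logTent r) := by
  unfold logTent
  have := Real.continuous_posLog
  fun_prop

/-- Subadditivity of `posLog` on products: `log⁺ (2y) ≤ log 2 + log⁺ y`. -/
theorem logTent_nonneg {r : ℝ} (u : ℂ) : 0 ≤ logTent r u := by
  unfold logTent
  have h : r⁻¹ * ‖u‖ = 2 * ((2 * r)⁻¹ * ‖u‖) := by
    rw [mul_inv]; ring
  have h2 := Real.posLog_mul (x := 2) (y := (2 * r)⁻¹ * ‖u‖)
  have h3 : posLog 2 = Real.log 2 := Real.posLog_eq_log (by norm_num)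
  rw [h]
  linarith

theorem logTent_eq_zero {r : ℝ} (hr : 0 < r) {u : ℂ} (hu : 2 * r ≤ ‖u‖) : logTent r u = 0 := by
  have hu0 : 0 < ‖u‖ := by linarith
  have h1 : 1 ≤ (2 * r)⁻¹ * ‖u‖ := by
    rw [inv_mul_eq_div, le_div_iff₀ (by positivity)]; linarith
  have h2 : 1 ≤ r⁻¹ * ‖u‖ := by
    rw [inv_mul_eq_div, le_div_iff₀ (by positivity)]; linarith
  rw [logTent, Real.posLog_eq_log (by rwa [abs_of_nonneg (by positivity)]),
    Real.posLog_eq_log (by rwa [abs_of_nonneg (by positivity)]),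
    Real.log_mul (by positivity) hu0.ne', Real.log_mul (by positivity) hu0.ne',
    Real.log_inv, Real.log_inv, Real.log_mul (by norm_num) hr.ne']
  ring

theorem logTent_zero (r : ℝ) : logTent r 0 = Real.log 2 := by
  simp [logTent]

theorem hasCompactSupport_logTent {r : ℝ} (hr : 0 < r) : HasCompactSupport (logTent r) :=
  HasCompactSupport.intro (isCompact_closedBall (0 : ℂ) (2 * r)) fun u hu =>
    logTent_eq_zero hr (by simpa using (not_le.mp fun h => hu (by simpa using h)).le)

theorem integral_logTent_pos {r : ℝ} (hr : 0 < r) : 0 < ∫ u, logTent r u := by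
  refine (continuous_logTent r).integral_pos_of_hasCompactSupport_nonneg_nonzero
    (hasCompactSupport_logTent hr) (fun u => logTent_nonneg u) (x := 0) ?_
  rw [logTent_zero]
  exact (Real.log_pos (by norm_num)).ne'

theorem circleAverage_log_norm_sub_sub_circleAverage {r : ℝ} (hr : 0 < r) (a w : ℂ) :
    circleAverage (fun z => Real.log ‖z - w‖) a (2 * r) -
      circleAverage (fun z => Real.log ‖z - w‖) a r = logTent r (a - w) := by
  rw [circleAverage_log_norm_sub_const_eq_log_radius_add_posLog (by positivity),
    circleAverage_log_norm_sub_const_eq_log_radius_add_posLog hr.ne',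
    Real.log_mul (by norm_num) hr.ne', logTent]
  ring

theorem circleIntegrable_log_norm_eval (p : Polynomial ℂ) (a : ℂ) (r : ℝ) :
    CircleIntegrable (fun z => Real.log ‖p.eval z‖) a r :=
  MeromorphicOn.circleIntegrable_log_norm (f := fun z => p.eval z) fun z _ =>
    (AnalyticOnNhd.eval_polynomial p z trivial).meromorphicAt

theorem ae_notMem_circleMap {s : Set ℂ} (hs : s.Finite) (a : ℂ) {r : ℝ} (hr : r ≠ 0) :
    ∀ᵐ θ : ℝ, circleMap a r θ ∉ s :=
  (hs.countable.preimage_circleMap a hr).ae_notMem _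

/-- **Jensen's formula** for a polynomial, in the form that does not see the leading
coefficient. -/
theorem circleAverage_log_norm_eval_sub {p : Polynomial ℂ} (hp : p ≠ 0) {r : ℝ} (hr : 0 < r)
    (a : ℂ) :
    circleAverage (fun z => Real.log ‖p.eval z‖) a (2 * r) -
      circleAverage (fun z => Real.log ‖p.eval z‖) a r =
    (p.roots.map fun w => logTent r (a - w)).sum := by
  have key (s : Multiset ℂ) (c : ℂ) (hc : c ≠ 0) :
      circleAverage (fun z => Real.log ‖c * (s.map fun w => z - w).prod‖) a (2 * r) -
      circleAverage (fun z => Real.log ‖c * (s.map fun w => z - w).prod‖) a r =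
      (s.map fun w => logTent r (a - w)).sum := by
    induction s using Multiset.induction with
    | empty => simp [Real.circleAverage_const]
    | cons w s ih =>
      have h (ρ : ℝ) (hρ : ρ ≠ 0) :
          circleAverage (fun z => Real.log ‖c * ((w ::ₘ s).map fun w => z - w).prod‖) a ρ =
          circleAverage (fun z => Real.log ‖z - w‖) a ρ +
          circleAverage (fun z => Real.log ‖c * (s.map fun w => z - w).prod‖) a ρ := by
        rw [← Real.circleAverage_fun_add (circleIntegrable_log_norm_sub_const ρ)]
        · rw [Real.circleAverage_def, Real.circleAverage_def]
          congr 1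
          refine intervalIntegral.integral_congr_ae ?_
          -- The logarithm of a product splits only where no factor vanishes; the circle meets the
          -- roots at a null set of angles.
          filter_upwards [ae_notMem_circleMap (w ::ₘ s).toFinset.finite_toSet a hρ] with θ hθ _
          have hθ' : ∀ v ∈ w ::ₘ s, circleMap a ρ θ - v ≠ 0 := by
            intro v hv h0
            apply hθ
            rw [sub_eq_zero] at h0
            simpa [h0] using hv
          have h1 : circleMap a ρ θ - w ≠ 0 := hθ' w (Multiset.mem_cons_self w s)
          have h2 : (s.map fun w => circleMap a ρ θ - w).prod ≠ 0 := by
            refine Multiset.prod_ne_zero fun h0 => ?_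
            obtain ⟨v, hv, h0⟩ := Multiset.mem_map.mp h0
            revert h0
            exact (fun v hv => hθ' v (Multiset.mem_cons_of_mem hv)) v hv
          simp only [Multiset.map_cons, Multiset.prod_cons, norm_mul]
          rw [Real.log_mul, Real.log_mul, Real.log_mul]
          · ring
          all_goals simp only [ne_eq, norm_eq_zero, mul_eq_zero, not_or]
          all_goals tauto
        · convert circleIntegrable_log_norm_eval
            (Polynomial.C c * (s.map fun w => Polynomial.X - Polynomial.C w).prod) a ρ using 4 with z
          simp [Polynomial.eval_multiset_prod]
      rw [h _ (by positivity), h _ hr.ne', Multiset.map_cons, Multiset.sum_cons, ← ih,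
        ← circleAverage_log_norm_sub_sub_circleAverage hr]
      ring
  have := key p.roots p.leadingCoeff (Polynomial.leadingCoeff_ne_zero.mpr hp)
  simp_rw [(IsAlgClosed.splits p).eval_eq_prod_roots]
  exact this

/-! ### Linear statistics of zeros controlled by log-moduli -/

/-- The tent, divided by its integral, is an approximate identity supported in a ball of radius
`2r`, taken to be the modulus of uniform continuity of `f` for `ε`. -/
theorem exists_integral_logTent_approx {f : ℂ → ℝ} (hf : Continuous f) (hfc : HasCompactSupport f)
    {ε : ℝ} (hε : 0 < ε) :
    ∃ r > 0, ∃ K : ℝ, ∀ w, |K * (∫ a, f a * logTent r (a - w)) - f w| ≤ ε := by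
  obtain ⟨δ, hδ, h⟩ := Metric.uniformContinuous_iff.mp
    (hfc.uniformContinuous_of_continuous hf) ε hε
  have hr : 0 < δ / 2 := by positivity
  have hI := integral_logTent_pos hr
  have hk : Integrable (logTent (δ / 2)) :=
    (continuous_logTent _).integrable_of_hasCompactSupport (hasCompactSupport_logTent hr)
  refine ⟨δ / 2, hr, (∫ u, logTent (δ / 2) u)⁻¹, fun w => ?_⟩
  have hfk : Integrable fun a => f (a + w) * logTent (δ / 2) a :=
    Continuous.integrable_of_hasCompactSupport
      (by have := continuous_logTent (δ / 2); fun_prop) (hasCompactSupport_logTent hr).mul_left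
  have e1 : ∫ a, f a * logTent (δ / 2) (a - w) = ∫ a, f (a + w) * logTent (δ / 2) a := by
    rw [← integral_add_right_eq_self _ w]
    simp
  have e2 : (∫ u, logTent (δ / 2) u)⁻¹ * (∫ a, f (a + w) * logTent (δ / 2) a) - f w =
      (∫ u, logTent (δ / 2) u)⁻¹ * ∫ a, (f (a + w) - f w) * logTent (δ / 2) a := by
    simp_rw [sub_mul]
    rw [integral_sub hfk (hk.const_mul _), integral_const_mul]
    field_simp
  rw [e1, e2, abs_mul, abs_of_pos (inv_pos.mpr hI), inv_mul_le_iff₀ hI, mul_comm,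
    ← integral_const_mul]
  refine (abs_integral_le_integral_abs).trans (integral_mono_of_nonneg
    (ae_of_all _ fun a => abs_nonneg _) (hk.const_mul ε) (ae_of_all _ fun a => ?_))
  simp only [abs_mul, abs_of_nonneg (logTent_nonneg _)]
  by_cases ha : ‖a‖ < δ
  · refine mul_le_mul_of_nonneg_right ?_ (logTent_nonneg _)
    have := h (a := a + w) (b := w) (by simpa using ha)
    rw [Real.dist_eq] at this
    exact this.le
  · rw [logTent_eq_zero hr (by linarith)]
    simp

theorem sum_roots_integral_mul_logTent {p : Polynomial ℂ} (hp : p ≠ 0) {f : ℂ → ℝ}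
    (hf : Continuous f) (hfc : HasCompactSupport f) {r : ℝ} (hr : 0 < r) :
    Integrable (fun a => f a * (circleAverage (fun z => Real.log ‖p.eval z‖) a (2 * r) -
      circleAverage (fun z => Real.log ‖p.eval z‖) a r)) ∧
    (p.roots.map fun w => ∫ a, f a * logTent r (a - w)).sum =
      ∫ a, f a * (circleAverage (fun z => Real.log ‖p.eval z‖) a (2 * r) -
        circleAverage (fun z => Real.log ‖p.eval z‖) a r) := by
  simp_rw [circleAverage_log_norm_eval_sub hp hr]
  have hi (w : ℂ) : Integrable fun a => f a * logTent r (a - w) :=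
    Continuous.integrable_of_hasCompactSupport
      (by have := continuous_logTent r; fun_prop) hfc.mul_right
  induction p.roots using Multiset.induction with
  | empty => simp
  | cons w s ih =>
    simp only [Multiset.map_cons, Multiset.sum_cons, mul_add]
    exact ⟨(hi w).add ih.1, by rw [integral_add (hi w) ih.1, ih.2]⟩

theorem enorm_circleAverage_le (g : ℂ → ℝ) (a : ℂ) (r : ℝ) :
    ‖circleAverage g a r‖ₑ ≤ ENNReal.ofReal (2 * Real.pi)⁻¹ *
      ∫⁻ θ in Set.Ioc 0 (2 * Real.pi), ‖g (circleMap a r θ)‖ₑ := by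
  rw [Real.circleAverage_def, smul_eq_mul, enorm_mul,
    intervalIntegral.integral_of_le (by positivity), Real.enorm_of_nonneg (by positivity)]
  gcongr
  exact enorm_integral_le_lintegral_enorm _

/-- By Tonelli the angle is integrated last; at a fixed angle the point of the circle is a translate
of its centre by a vector of length `r`, so the ball of radius `R` lands in that of radius `R + r`.
-/
theorem lintegral_mul_enorm_circleAverage_le {f g : ℂ → ℝ} (hg : Measurable g) {M : ℝ≥0∞} {R : ℝ}
    (hM : ∀ a, ‖f a‖ₑ ≤ M) (hR : Function.support f ⊆ Metric.ball 0 R) {r : ℝ} (hr : 0 ≤ r) :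
    ∫⁻ a, ‖f a‖ₑ * ‖circleAverage g a r‖ₑ ≤ M * ∫⁻ z in Metric.ball 0 (R + r), ‖g z‖ₑ := by
  have hcm : Measurable fun x : ℂ × ℝ => ‖g (circleMap x.1 r x.2)‖ₑ := by
    unfold circleMap
    fun_prop
  have hball (θ : ℝ) : ∫⁻ a in Metric.ball 0 R, ‖g (circleMap a r θ)‖ₑ ≤
      ∫⁻ z in Metric.ball 0 (R + r), ‖g z‖ₑ := by
    have hmp : MeasurePreserving (fun a : ℂ => a + r * Complex.exp (θ * Complex.I)) :=
      measurePreserving_add_right volume _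
    have : ∫⁻ z in Metric.ball 0 (R + r), ‖g z‖ₑ =
        ∫⁻ a in (fun a : ℂ => a + r * Complex.exp (θ * Complex.I)) ⁻¹' Metric.ball 0 (R + r),
          ‖g (a + r * Complex.exp (θ * Complex.I))‖ₑ :=
      (hmp.setLIntegral_comp_preimage Metric.isOpen_ball.measurableSet hg.enorm).symm
    rw [this]
    refine lintegral_mono_set fun a ha => ?_
    rw [mem_ball_zero_iff] at ha
    rw [Set.mem_preimage, mem_ball_zero_iff]
    refine (norm_add_le _ _).trans_lt ?_
    rw [norm_mul, Complex.norm_exp_ofReal_mul_I, Complex.norm_real, Real.norm_of_nonneg hr]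
    linarith
  calc ∫⁻ a, ‖f a‖ₑ * ‖circleAverage g a r‖ₑ
    _ = ∫⁻ a in Metric.ball 0 R, ‖f a‖ₑ * ‖circleAverage g a r‖ₑ := by
        refine (setLIntegral_eq_of_support_subset ?_).symm
        refine fun a ha => hR fun h0 => ha ?_
        simp [h0]
    _ ≤ ∫⁻ a in Metric.ball 0 R, M * (ENNReal.ofReal (2 * Real.pi)⁻¹ *
          ∫⁻ θ in Set.Ioc 0 (2 * Real.pi), ‖g (circleMap a r θ)‖ₑ) :=
        lintegral_mono fun a => mul_le_mul' (hM a) (enorm_circleAverage_le g a r)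
    _ = M * (ENNReal.ofReal (2 * Real.pi)⁻¹ * ∫⁻ θ in Set.Ioc 0 (2 * Real.pi),
          ∫⁻ a in Metric.ball 0 R, ‖g (circleMap a r θ)‖ₑ) := by
        rw [lintegral_const_mul _ (hcm.lintegral_prod_right'.const_mul _),
          lintegral_const_mul _ hcm.lintegral_prod_right', lintegral_lintegral_swap
          (f := fun a θ => ‖g (circleMap a r θ)‖ₑ) hcm.aemeasurable]
    _ ≤ M * (ENNReal.ofReal (2 * Real.pi)⁻¹ * ∫⁻ θ in Set.Ioc 0 (2 * Real.pi),
          ∫⁻ z in Metric.ball 0 (R + r), ‖g z‖ₑ) := by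
        exact mul_le_mul_right (mul_le_mul_right (lintegral_mono hball) _) _
    _ = M * ∫⁻ z in Metric.ball 0 (R + r), ‖g z‖ₑ := by
        rw [lintegral_const, Measure.restrict_apply_univ, Real.volume_Ioc, sub_zero,
          mul_comm _ (ENNReal.ofReal (2 * Real.pi)), ← mul_assoc (ENNReal.ofReal _),
          ← ENNReal.ofReal_mul (by positivity), inv_mul_cancel₀ (by positivity),
          ENNReal.ofReal_one, one_mul]

/-- Linear statistics of the zeros of two polynomials differ by at most the local `L¹` distance of
the logarithms of their moduli, up to a small multiple of the number of zeros. -/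
theorem exists_enorm_sum_roots_sub_sum_roots_le {f : ℂ → ℝ} (hf : Continuous f)
    (hfc : HasCompactSupport f) {ε : ℝ} (hε : 0 < ε) :
    ∃ R : ℝ, ∃ C : ℝ≥0∞, C ≠ ∞ ∧ ∀ p q : Polynomial ℂ, p ≠ 0 → q ≠ 0 →
      ‖(p.roots.map f).sum - (q.roots.map f).sum‖ₑ ≤
        ENNReal.ofReal (ε * (Multiset.card p.roots + Multiset.card q.roots)) +
        C * ∫⁻ z in Metric.ball 0 R, ‖Real.log ‖p.eval z‖ - Real.log ‖q.eval z‖‖ₑ := by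
  obtain ⟨r, hr, K, hK⟩ := exists_integral_logTent_approx hf hfc hε
  obtain ⟨M, hM⟩ := hfc.exists_bound_of_continuous hf
  obtain ⟨R, hR⟩ := hfc.isCompact.isBounded.subset_ball (0 : ℂ)
  have hR' : Function.support f ⊆ Metric.ball 0 R := (subset_tsupport f).trans hR
  have hM' : ∀ a, ‖f a‖ₑ ≤ ENNReal.ofReal M := fun a => by
    rw [← ofReal_norm]
    exact ENNReal.ofReal_le_ofReal (hM a)
  -- Circles of radius at most `2r` centred in the support of `f` stay in this ball; one `M` is paid
  -- for each of the two radii.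
  refine ⟨R + 2 * r, ‖K‖ₑ * (ENNReal.ofReal M + ENNReal.ofReal M), by finiteness,
    fun p q hp hq => ?_⟩
  set F : ℂ → ℝ := fun w => ∫ a, f a * logTent r (a - w)
  have happrox (s : Multiset ℂ) : |(s.map f).sum - K * (s.map F).sum| ≤ ε * Multiset.card s := by
    induction s using Multiset.induction with
    | empty => simp
    | cons w s ih =>
      simp only [Multiset.map_cons, Multiset.sum_cons, Multiset.card_cons, Nat.cast_add,
        Nat.cast_one]
      have h1 := hK w
      change |K * F w - f w| ≤ ε at h1
      rw [abs_le] at h1 ih ⊢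
      constructor <;> linarith [h1.1, h1.2, ih.1, ih.2]
  set L : ℂ → ℝ := fun z => Real.log ‖p.eval z‖ - Real.log ‖q.eval z‖
  have hL : Measurable L := by
    have h1 := p.continuous.measurable
    have h2 := q.continuous.measurable
    fun_prop
  have hcA (a : ℂ) (ρ : ℝ) : circleAverage L a ρ =
      circleAverage (fun z => Real.log ‖p.eval z‖) a ρ -
      circleAverage (fun z => Real.log ‖q.eval z‖) a ρ :=
    Real.circleAverage_fun_sub (circleIntegrable_log_norm_eval p a ρ)
      (circleIntegrable_log_norm_eval q a ρ)
  have hF : (p.roots.map F).sum - (q.roots.map F).sum =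
      ∫ a, f a * (circleAverage L a (2 * r) - circleAverage L a r) := by
    obtain ⟨ip, ep⟩ := sum_roots_integral_mul_logTent hp hf hfc hr
    obtain ⟨iq, eq⟩ := sum_roots_integral_mul_logTent hq hf hfc hr
    rw [ep, eq, ← integral_sub ip iq]
    congr 1 with a
    rw [hcA, hcA]
    ring
  have hFle : ‖(p.roots.map F).sum - (q.roots.map F).sum‖ₑ ≤
      (ENNReal.ofReal M + ENNReal.ofReal M) * ∫⁻ z in Metric.ball 0 (R + 2 * r), ‖L z‖ₑ := by
    have hm : AEMeasurable (fun a => ‖f a‖ₑ * ‖circleAverage L a (2 * r)‖ₑ) := by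
      have : Measurable fun a => circleAverage L a (2 * r) := by
        unfold Real.circleAverage
        simp_rw [intervalIntegral.integral_of_le Real.two_pi_pos.le]
        have h2 : StronglyMeasurable fun x : ℂ × ℝ => L (circleMap x.1 (2 * r) x.2) := by
          refine Measurable.stronglyMeasurable ?_
          unfold circleMap
          fun_prop
        exact Measurable.const_mul h2.integral_prod_right'.measurable _
      have := hf.measurable
      fun_prop
    rw [hF]
    calc ‖∫ a, f a * (circleAverage L a (2 * r) - circleAverage L a r)‖ₑ
      _ ≤ ∫⁻ a, ‖f a * (circleAverage L a (2 * r) - circleAverage L a r)‖ₑ :=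
          enorm_integral_le_lintegral_enorm _
      _ ≤ ∫⁻ a, (‖f a‖ₑ * ‖circleAverage L a (2 * r)‖ₑ + ‖f a‖ₑ * ‖circleAverage L a r‖ₑ) := by
          refine lintegral_mono fun a => ?_
          rw [enorm_mul, ← mul_add]
          gcongr
          exact enorm_sub_le
      _ = (∫⁻ a, ‖f a‖ₑ * ‖circleAverage L a (2 * r)‖ₑ) +
            ∫⁻ a, ‖f a‖ₑ * ‖circleAverage L a r‖ₑ := lintegral_add_left' hm _
      _ ≤ _ := by
          rw [add_mul]
          gcongr
          · exact lintegral_mul_enorm_circleAverage_le hL hM' hR' (by positivity)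
          · refine (lintegral_mul_enorm_circleAverage_le hL hM' hR' hr.le).trans ?_
            gcongr
            linarith
  -- Replacing `f` by its smoothing `K * F` costs `ε` per root; only the smoothed statistics are
  -- compared through `L`.
  have hsplit : (p.roots.map f).sum - (q.roots.map f).sum =
      (((p.roots.map f).sum - K * (p.roots.map F).sum) -
        ((q.roots.map f).sum - K * (q.roots.map F).sum)) +
      K * ((p.roots.map F).sum - (q.roots.map F).sum) := by ring
  rw [hsplit]
  refine (enorm_add_le _ _).trans (add_le_add ?_ ?_)
  · rw [← ofReal_norm]
    refine ENNReal.ofReal_le_ofReal ((norm_sub_le _ _).trans ?_)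
    rw [mul_add]
    exact add_le_add (happrox _) (happrox _)
  · rw [enorm_mul, mul_assoc]
    gcongr

/-! ### Weak convergence and empirical measures -/

/-- Vague convergence without loss of mass implies weak convergence. -/
theorem tendsto_finiteMeasure_of_integral_compactSupport_sub {μs νs : ℕ → FiniteMeasure ℂ}
    {μ : FiniteMeasure ℂ} (hμ : Tendsto μs atTop (𝓝 μ))
    (hμs : ∀ᶠ n in atTop, (μs n).mass = 1) (hνs : ∀ᶠ n in atTop, (νs n).mass = 1)
    (h : ∀ f : ℂ → ℝ, Continuous f → HasCompactSupport f →
      Tendsto (fun n => ∫ z, f z ∂(νs n : Measure ℂ) - ∫ z, f z ∂(μs n : Measure ℂ)) atTop (𝓝 0)) :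
    Tendsto νs atTop (𝓝 μ) := by
  have hmass : μ.mass = 1 := by
    refine tendsto_nhds_unique ((FiniteMeasure.continuous_mass.tendsto μ).comp hμ) ?_
    exact tendsto_const_nhds.congr' (hμs.mono fun n hn => hn.symm)
  have hreal {ν : FiniteMeasure ℂ} (hν : ν.mass = 1) : (ν : Measure ℂ).real Set.univ = 1 := by
    change ((ν.mass : ℝ≥0) : ℝ) = 1
    simp [hν]
  have hcc (f : ℂ → ℝ) (hf : Continuous f) (hfc : HasCompactSupport f) :
      Tendsto (fun n => ∫ z, f z ∂(νs n : Measure ℂ)) atTop (𝓝 (∫ z, f z ∂(μ : Measure ℂ))) := by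
    obtain ⟨C, hC⟩ := hfc.exists_bound_of_continuous hf
    have := (FiniteMeasure.tendsto_iff_forall_integral_tendsto.mp hμ)
      (BoundedContinuousFunction.ofNormedAddCommGroup f hf C hC)
    simpa using (h f hf hfc).add this
  rw [FiniteMeasure.tendsto_iff_forall_integral_tendsto]
  intro f
  -- Cutoffs equal to `1` on the ball of radius `m` and to `0` off that of radius `m + 1`; since all
  -- masses are `1`, the mass outside is read off from the integral of a compactly supported
  -- function.
  set χ : ℕ → ℂ → ℝ := fun m z => max 0 (min 1 (m + 1 - ‖z‖)) with hχ
  have hχ0 (m z) : 0 ≤ χ m z := le_max_left _ _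
  have hχ1 (m z) : χ m z ≤ 1 := max_le zero_le_one (min_le_left _ _)
  have hχc (m) : Continuous (χ m) := by
    simp only [hχ]
    fun_prop
  have hχs (m) : HasCompactSupport (χ m) := by
    refine HasCompactSupport.intro (isCompact_closedBall (0 : ℂ) (m + 1)) fun u hu => ?_
    rw [mem_closedBall_zero_iff, not_le] at hu
    exact max_eq_left ((min_le_right _ _).trans (by linarith))
  have hχi (ν : FiniteMeasure ℂ) (m) : Integrable (χ m) (ν : Measure ℂ) :=
    (hχc m).integrable_of_hasCompactSupport (hχs m)
  have hχlim : Tendsto (fun m => ∫ z, χ m z ∂(μ : Measure ℂ)) atTop (𝓝 1) := by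
    have : ∫ _, (1 : ℝ) ∂(μ : Measure ℂ) = 1 := by simp [hreal hmass]
    rw [← this]
    refine tendsto_integral_of_dominated_convergence (fun _ => 1)
      (fun m => (hχc m).aestronglyMeasurable) (integrable_const _)
      (fun m => ae_of_all _ fun z => ?_) (ae_of_all _ fun z => ?_)
    · rw [Real.norm_of_nonneg (hχ0 m z)]
      exact hχ1 m z
    · refine tendsto_const_nhds.congr' ?_
      filter_upwards [eventually_ge_atTop ⌈‖z‖⌉₊] with m hm
      have : ‖z‖ ≤ m := (Nat.le_ceil _).trans (by exact_mod_cast hm)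
      simp only [hχ]
      rw [min_eq_left (by linarith), max_eq_right zero_le_one]
  have htail {ν : FiniteMeasure ℂ} (hν : ν.mass = 1) (m : ℕ) :
      |∫ z, f z ∂(ν : Measure ℂ) - ∫ z, f z * χ m z ∂(ν : Measure ℂ)| ≤
        ‖f‖ * (1 - ∫ z, χ m z ∂(ν : Measure ℂ)) := by
    have hfi : Integrable (fun z => f z) (ν : Measure ℂ) := f.integrable _
    have hfχ : Integrable (fun z => f z * χ m z) (ν : Measure ℂ) :=
      Continuous.integrable_of_hasCompactSupport (f.continuous.mul (hχc m)) (hχs m).mul_left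
    have e : 1 - ∫ z, χ m z ∂(ν : Measure ℂ) = ∫ z, (1 - χ m z) ∂(ν : Measure ℂ) := by
      rw [integral_sub (integrable_const _) (hχi ν m)]
      simp [hreal hν]
    rw [← integral_sub hfi hfχ, e, ← integral_const_mul]
    refine abs_integral_le_integral_abs.trans (integral_mono_of_nonneg
      (ae_of_all _ fun _ => abs_nonneg _)
      (((integrable_const _).sub (hχi ν m)).const_mul _) (ae_of_all _ fun z => ?_))
    have : f z - f z * χ m z = f z * (1 - χ m z) := by ring
    simp only [this, abs_mul]
    rw [abs_of_nonneg (sub_nonneg.mpr (hχ1 m z))]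
    exact mul_le_mul_of_nonneg_right (f.norm_coe_le_norm z) (sub_nonneg.mpr (hχ1 m z))
  rw [Metric.tendsto_atTop']
  intro ε hε
  -- The tail of `μ` costs `‖f‖ * δ`, that of `νs n` twice as much, and the truncated integrals
  -- differ by less than `δ`.
  obtain ⟨δ, hδ, hδε⟩ : ∃ δ > 0, 3 * (‖f‖ * δ) + δ < ε := by
    refine ⟨ε / (3 * ‖f‖ + 2), by positivity, ?_⟩
    have : 3 * (‖f‖ * (ε / (3 * ‖f‖ + 2))) + ε / (3 * ‖f‖ + 2) =
        ε * ((3 * ‖f‖ + 1) / (3 * ‖f‖ + 2)) := by ring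
    rw [this]
    refine mul_lt_of_lt_one_right hε ?_
    rw [div_lt_one (by positivity)]
    linarith
  obtain ⟨m, hm⟩ := (hχlim.eventually (lt_mem_nhds (show 1 - δ < 1 by linarith))).exists
  have h1 := hcc _ (hχc m) (hχs m)
  have h2 := hcc (fun z => f z * χ m z) (f.continuous.mul (hχc m)) (hχs m).mul_left
  have ev : ∀ᶠ n in atTop,
      dist (∫ z, f z ∂(νs n : Measure ℂ)) (∫ z, f z ∂(μ : Measure ℂ)) < ε := by
    filter_upwards [hνs, (Metric.tendsto_nhds.mp h1) δ hδ, (Metric.tendsto_nhds.mp h2) δ hδ]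
      with n hn h1n h2n
    have t1 := htail hn m
    have t2 := htail hmass m
    rw [Real.dist_eq, abs_lt] at h1n h2n
    have t1' : ‖f‖ * (1 - ∫ z, χ m z ∂(νs n : Measure ℂ)) ≤ ‖f‖ * (2 * δ) :=
      mul_le_mul_of_nonneg_left (by linarith [h1n.1]) (norm_nonneg _)
    have t2' : ‖f‖ * (1 - ∫ z, χ m z ∂(μ : Measure ℂ)) ≤ ‖f‖ * δ :=
      mul_le_mul_of_nonneg_left (by linarith) (norm_nonneg _)
    rw [abs_le] at t1 t2
    rw [Real.dist_eq, abs_lt]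
    constructor <;> linarith [t1.1, t1.2, t2.1, t2.2, h2n.1, h2n.2]
  obtain ⟨N, hN⟩ := eventually_atTop.mp ev
  exact ⟨N, fun n hn => hN n hn.le⟩

theorem mass_empiricalMeasure {s : Multiset ℂ} (hs : s ≠ 0) : (empiricalMeasure s).mass = 1 := by
  have h (s : Multiset ℂ) : FiniteMeasure.mass
      (s.map fun z => (diracProba z).toFiniteMeasure).sum = Multiset.card s := by
    induction s using Multiset.induction with
    | empty => simp
    | cons z s ih =>
      rw [Multiset.map_cons, Multiset.sum_cons, FiniteMeasure.mass, FiniteMeasure.coeFn_add,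
        Pi.add_apply]
      change FiniteMeasure.mass _ + FiniteMeasure.mass _ = _
      rw [ih]
      simp [add_comm]
  rw [empiricalMeasure, FiniteMeasure.mass, FiniteMeasure.coeFn_smul, Pi.smul_apply]
  change _ • FiniteMeasure.mass _ = _
  rw [h, smul_eq_mul, inv_mul_cancel₀]
  simpa using hs

theorem integral_empiricalMeasure (s : Multiset ℂ) (f : ℂ → ℝ) :
    ∫ z, f z ∂(empiricalMeasure s : Measure ℂ) = (Multiset.card s : ℝ)⁻¹ * (s.map f).sum := by
  have h (s : Multiset ℂ) :
      Integrable f ((s.map fun z => (diracProba z).toFiniteMeasure).sum : FiniteMeasure ℂ) ∧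
      ∫ z, f z ∂((s.map fun z => (diracProba z).toFiniteMeasure).sum : FiniteMeasure ℂ) =
        (s.map f).sum := by
    induction s using Multiset.induction with
    | empty => simp
    | cons w s ih =>
      have hd : ((diracProba w).toFiniteMeasure : Measure ℂ) = Measure.dirac w := rfl
      have hw : Integrable f ((diracProba w).toFiniteMeasure : Measure ℂ) := by
        rw [hd]
        exact integrable_dirac (by simp)
      have hv : ∫ z, f z ∂((diracProba w).toFiniteMeasure : Measure ℂ) = f w := by
        rw [hd, integral_dirac]
      rw [Multiset.map_cons, Multiset.sum_cons, FiniteMeasure.toMeasure_add]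
      exact ⟨hw.add_measure ih.1, by
        rw [integral_add_measure hw ih.1, hv, ih.2, Multiset.map_cons, Multiset.sum_cons]⟩
  rw [empiricalMeasure, FiniteMeasure.toMeasure_smul, integral_smul_nnreal_measure, (h s).2,
    NNReal.smul_def]
  simp

/-! ### Root counts and the comparison criterion -/

theorem roots_zeroPolynomial {n : ℕ} (Z : Fin n → ℂ) :
    (zeroPolynomial Z).roots = Finset.univ.val.map Z := by
  rw [← Polynomial.roots_multiset_prod_X_sub_C (Finset.univ.val.map Z), Multiset.map_map]
  rfl

theorem zeroPolynomial_ne_zero {n : ℕ} (Z : Fin n → ℂ) : zeroPolynomial Z ≠ 0 :=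
  (Polynomial.monic_prod_X_sub_C Z _).ne_zero

/-- Each summand is `γ k` times a monic polynomial of degree `n`, so the coefficient of `X ^ n` is
`-∑ γ k`. -/
theorem natDegree_circularDerivative {n : ℕ} (Z : Fin n → ℂ) {γ : Fin n → ℝ}
    (hγ : ∑ k, γ k ≠ 0) : (circularDerivative Z γ).natDegree = n := by
  have hdeg (k : Fin n) : ((Polynomial.C (γ k : ℂ) * (Polynomial.C (Z k) + Polynomial.X) *
      ∏ l ∈ Finset.univ.erase k, (Polynomial.X - Polynomial.C (Z l)))).natDegree ≤ n ∧
      ((Polynomial.C (γ k : ℂ) * (Polynomial.C (Z k) + Polynomial.X) *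
      ∏ l ∈ Finset.univ.erase k, (Polynomial.X - Polynomial.C (Z l)))).coeff n = (γ k : ℂ) := by
    have hm : ((Polynomial.X + Polynomial.C (Z k)) *
        ∏ l ∈ Finset.univ.erase k, (Polynomial.X - Polynomial.C (Z l))).Monic :=
      (Polynomial.monic_X_add_C _).mul (Polynomial.monic_prod_X_sub_C _ _)
    have hd : ((Polynomial.X + Polynomial.C (Z k)) *
        ∏ l ∈ Finset.univ.erase k, (Polynomial.X - Polynomial.C (Z l))).natDegree = n := by
      rw [(Polynomial.monic_X_add_C _).natDegree_mul (Polynomial.monic_prod_X_sub_C _ _),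
        Polynomial.natDegree_X_add_C, Polynomial.natDegree_finsetProd_X_sub_C_eq_card,
        Finset.card_erase_of_mem (Finset.mem_univ k), Finset.card_univ, Fintype.card_fin]
      have := k.pos
      omega
    rw [mul_assoc, add_comm (Polynomial.C (Z k))]
    refine ⟨(Polynomial.natDegree_C_mul_le _ _).trans hd.le, ?_⟩
    have := hm.coeff_natDegree
    rw [hd] at this
    rw [Polynomial.coeff_C_mul, this, mul_one]
  refine Polynomial.natDegree_eq_of_le_of_coeff_ne_zero ?_ ?_
  · rw [circularDerivative, Polynomial.natDegree_neg]
    exact Polynomial.natDegree_sum_le_of_forall_le _ _ fun k _ => (hdeg k).1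
  · rw [circularDerivative, Polynomial.coeff_neg, Polynomial.finsetSum_coeff]
    rw [Finset.sum_congr rfl fun k _ => (hdeg k).2]
    rw [neg_ne_zero]
    exact_mod_cast hγ

theorem card_roots_circularDerivative {n : ℕ} (Z : Fin n → ℂ) {γ : Fin n → ℝ}
    (hγ : ∑ k, γ k ≠ 0) : Multiset.card (circularDerivative Z γ).roots = n := by
  rw [← (IsAlgClosed.splits _).natDegree_eq_card_roots, natDegree_circularDerivative Z hγ]

theorem tendsto_empiricalMeasure_roots {p q : ℕ → Polynomial ℂ} {μ : FiniteMeasure ℂ}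
    (hp : ∀ᶠ n in atTop, Multiset.card (p n).roots = n)
    (hq : ∀ᶠ n in atTop, Multiset.card (q n).roots = n)
    (h : ∀ R : ℝ, Tendsto (fun n : ℕ => (n : ℝ≥0∞)⁻¹ *
      ∫⁻ z in Metric.ball 0 R, ‖Real.log ‖(p n).eval z‖ - Real.log ‖(q n).eval z‖‖ₑ) atTop (𝓝 0))
    (hμ : Tendsto (fun n => empiricalMeasure (q n).roots) atTop (𝓝 μ)) :
    Tendsto (fun n => empiricalMeasure (p n).roots) atTop (𝓝 μ) := by
  have hmass {p : ℕ → Polynomial ℂ} (hp : ∀ᶠ n in atTop, Multiset.card (p n).roots = n) :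
      ∀ᶠ n in atTop, (empiricalMeasure (p n).roots).mass = 1 := by
    filter_upwards [hp, eventually_gt_atTop 0] with n hn h0
    refine mass_empiricalMeasure fun h => ?_
    simp [h] at hn
    omega
  refine tendsto_finiteMeasure_of_integral_compactSupport_sub hμ (hmass hq) (hmass hp)
    fun f hf hfc => ?_
  rw [tendsto_zero_iff_enorm_tendsto_zero, ENNReal.tendsto_nhds_zero]
  intro ε hε
  -- Both polynomials have `n` roots, so an error `ε'` per root becomes `2 * ε'` after division by
  -- `n`.
  obtain ⟨ε', hε', hεε⟩ : ∃ ε' : ℝ, 0 < ε' ∧ ENNReal.ofReal (2 * ε') ≤ ε / 2 := by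
    rcases eq_or_ne ε ∞ with rfl | hε1
    · exact ⟨1, one_pos, by simp [ENNReal.top_div_of_ne_top]⟩
    · refine ⟨ε.toReal / 4, div_pos (ENNReal.toReal_pos hε.ne' hε1) (by norm_num), ?_⟩
      rw [show 2 * (ε.toReal / 4) = ε.toReal / 2 by ring, ENNReal.ofReal_div_of_pos (by norm_num),
        ENNReal.ofReal_toReal hε1]
      simp
  obtain ⟨R, C, hC, hb⟩ := exists_enorm_sum_roots_sub_sum_roots_le hf hfc hε'
  have hlim : Tendsto (fun n : ℕ => C * ((n : ℝ≥0∞)⁻¹ *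
      ∫⁻ z in Metric.ball 0 R, ‖Real.log ‖(p n).eval z‖ - Real.log ‖(q n).eval z‖‖ₑ))
      atTop (𝓝 0) := by
    simpa using ENNReal.Tendsto.const_mul (h R) (Or.inr hC)
  filter_upwards [hp, hq, eventually_gt_atTop 0,
    ENNReal.tendsto_nhds_zero.mp hlim (ε / 2) (ENNReal.half_pos hε.ne')] with n hpn hqn h0 hn
  have hne {p : Polynomial ℂ} (hp : Multiset.card p.roots = n) : p ≠ 0 := by
    rintro rfl
    simp at hp
    omega
  have hb' := hb (p n) (q n) (hne hpn) (hne hqn)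
  rw [hpn, hqn] at hb'
  rw [integral_empiricalMeasure, integral_empiricalMeasure, hpn, hqn, ← mul_sub, enorm_mul]
  have hn0 : (n : ℝ≥0∞) ≠ 0 := by exact_mod_cast h0.ne'
  have hni : ‖(n : ℝ)⁻¹‖ₑ = (n : ℝ≥0∞)⁻¹ := by
    rw [enorm_inv (by exact_mod_cast h0.ne')]
    simp
  rw [hni]
  calc _ ≤ _ := mul_le_mul_right hb' _
    _ = ENNReal.ofReal (2 * ε') + C * ((n : ℝ≥0∞)⁻¹ *
      ∫⁻ z in Metric.ball 0 R, ‖Real.log ‖(p n).eval z‖ - Real.log ‖(q n).eval z‖‖ₑ) := by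
        rw [mul_add, show ε' * ((n : ℝ) + n) = n * (2 * ε') by ring,
          ENNReal.ofReal_mul (by positivity), ENNReal.ofReal_natCast, ← mul_assoc,
          ENNReal.inv_mul_cancel hn0 (by simp), one_mul, mul_left_comm]
    _ ≤ ε / 2 + ε / 2 := add_le_add hεε hn
    _ = ε := ENNReal.add_halves ε

/-! ### Fractional moments of the gamma law -/

theorem setLIntegral_ball_enorm_rpow_neg_lt_top {E : Type*} [NormedAddCommGroup E]
    [NormedSpace ℝ E] [FiniteDimensional ℝ E] [Nontrivial E] [MeasurableSpace E] [BorelSpace E]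
    (μ : Measure E) [μ.IsAddHaarMeasure] {α : ℝ} (hα : α < Module.finrank ℝ E) (R : ℝ) :
    ∫⁻ x in Metric.ball 0 R, ‖x‖ₑ ^ (-α) ∂μ < ∞ := by
  have hint : IntegrableOn (fun x : E => ‖x‖ ^ (-α)) (Metric.ball 0 R) μ :=
    integrableOn_ball_of_norm_le_rpow (C := 1) Module.finrank_pos hα
      (ae_of_all _ fun x => by rw [Real.norm_of_nonneg (by positivity), one_mul])
      (by have : Measurable fun x : E => ‖x‖ ^ (-α) := by fun_prop
          exact this.aestronglyMeasurable)
  refine lt_of_eq_of_lt (lintegral_congr_ae ?_) hint.2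
  filter_upwards [ae_restrict_of_ae (Measure.ae_ne μ (0 : E))] with x hx
  rw [Real.enorm_of_nonneg (by positivity), ← ENNReal.ofReal_rpow_of_pos (by simpa using hx),
    ofReal_norm]

/-- The larger of `x⁻¹` and `y⁻¹` absorbs the other. This decouples two singularities, making
integral bounds uniform in the distance between them. -/
theorem ENNReal.rpow_neg_mul_rpow_neg_le (x y : ℝ≥0∞) {p q : ℝ} (hp : 0 ≤ p) (hq : 0 ≤ q) :
    x ^ (-p) * y ^ (-q) ≤ x ^ (-(p + q)) + y ^ (-(p + q)) := by
  simp only [ENNReal.rpow_neg, ← ENNReal.inv_rpow]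
  rcases le_total x⁻¹ y⁻¹ with h | h
  · calc x⁻¹ ^ p * y⁻¹ ^ q ≤ y⁻¹ ^ p * y⁻¹ ^ q := by gcongr
      _ = y⁻¹ ^ (p + q) := (ENNReal.rpow_add_of_nonneg _ _ hp hq).symm
      _ ≤ _ := le_add_self
  · calc x⁻¹ ^ p * y⁻¹ ^ q ≤ x⁻¹ ^ p * x⁻¹ ^ q := by gcongr
      _ = x⁻¹ ^ (p + q) := (ENNReal.rpow_add_of_nonneg _ _ hp hq).symm
      _ ≤ _ := le_self_add

theorem ENNReal.rpow_neg_le_one_of_one_le {x : ℝ≥0∞} (hx : 1 ≤ x) {p : ℝ} (hp : 0 ≤ p) :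
    x ^ (-p) ≤ 1 := by
  simpa using ENNReal.rpow_le_rpow_of_exponent_le hx (neg_nonpos.mpr hp)

theorem Real.rpow_mul_exp_neg_le {c x : ℝ} (hc : 0 < c) (hx : 0 ≤ x) :
    x ^ c * Real.exp (-x) ≤ c ^ c := by
  have h1 : x / c ≤ Real.exp (x / c) := by linarith [Real.add_one_le_exp (x / c)]
  have h2 := Real.rpow_le_rpow (by positivity) h1 hc.le
  rw [← Real.exp_mul, div_mul_cancel₀ _ hc.ne', Real.div_rpow hx hc.le,
    div_le_iff₀ (by positivity)] at h2
  rw [Real.exp_neg, ← div_eq_mul_inv, div_le_iff₀ (Real.exp_pos x)]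
  linarith

/-- The density is `O(|x|^(b - 1))` with `b = min a 1`. Multiplied by `|x + t|^(-s)`, it has
singularities of total order `1 - b + s < 1`, which remain integrable even when they merge. -/
theorem exists_lintegral_enorm_add_rpow_neg_gammaMeasure_le {a s : ℝ} (hs : 0 ≤ s) (hsa : s < a)
    (hs1 : s < 1) :
    ∃ C : ℝ≥0∞, C ≠ ∞ ∧ ∀ t : ℝ, ∫⁻ x, ‖x + t‖ₑ ^ (-s) ∂(gammaMeasure a 1) ≤ C := by
  have ha : 0 < a := hs.trans_lt hsa
  have hprob := isProbabilityMeasure_gammaMeasure ha one_pos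
  set b := min a 1 with hb
  have hb1 : b ≤ 1 := min_le_right _ _
  have hsb : s < b := lt_min hsa hs1
  obtain ⟨D, hD, hpdf⟩ : ∃ D : ℝ≥0∞, D ≠ ∞ ∧ ∀ x ≠ 0,
      gammaPDF a 1 x ≤ D * ‖x‖ₑ ^ (-(1 - b)) := by
    refine ⟨ENNReal.ofReal (1 / Real.Gamma a * max 1 ((a - 1) ^ (a - 1))), by finiteness,
      fun x hx => ?_⟩
    rcases hx.lt_or_gt with hx | hx
    · simp [gammaPDF_of_neg hx]
    rw [gammaPDF_of_nonneg hx.le, Real.enorm_of_nonneg hx.le, ENNReal.ofReal_rpow_of_pos hx,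
      ← ENNReal.ofReal_mul (by positivity)]
    refine ENNReal.ofReal_le_ofReal ?_
    rw [Real.one_rpow, one_mul, mul_assoc, mul_assoc]
    refine mul_le_mul_of_nonneg_left ?_ (by have := Real.Gamma_pos_of_pos ha; positivity)
    rcases le_or_gt a 1 with h | h
    · rw [hb, min_eq_left h, neg_sub]
      rw [mul_comm]
      refine mul_le_mul_of_nonneg_right ?_ (by positivity)
      exact (Real.exp_le_one_iff.mpr (by linarith)).trans (le_max_left _ _)
    · rw [hb, min_eq_right h.le, sub_self, neg_zero, Real.rpow_zero, mul_one]
      exact (Real.rpow_mul_exp_neg_le (by linarith) hx.le).trans (le_max_right _ _)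
  set α := 1 - b + s with hα
  set I := ∫⁻ x : ℝ in Metric.ball 0 1, ‖x‖ₑ ^ (-α) with hI
  have hIlt : I < ∞ := setLIntegral_ball_enorm_rpow_neg_lt_top volume
    (by simp only [Module.finrank_self, Nat.cast_one]; linarith) 1
  refine ⟨1 + D * (I + I), by finiteness, fun t => ?_⟩
  set h : ℝ → ℝ≥0∞ := (Metric.ball (0 : ℝ) 1).indicator fun x => ‖x‖ₑ ^ (-α) with hh
  have hhm : Measurable h := by
    refine Measurable.indicator (by fun_prop) Metric.isOpen_ball.measurableSet
  have hhI : ∫⁻ x, h x = I := lintegral_indicator Metric.isOpen_ball.measurableSet _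
  have hpt (x : ℝ) (hx : x ≠ 0) : gammaPDF a 1 x * ‖x + t‖ₑ ^ (-s) ≤
      gammaPDF a 1 x + D * (h x + h (x + t)) := by
    rcases le_or_gt 1 ‖x + t‖ₑ with h1 | h1
    · have : ‖x + t‖ₑ ^ (-s) ≤ 1 := ENNReal.rpow_neg_le_one_of_one_le h1 hs
      calc _ ≤ gammaPDF a 1 x * 1 := by gcongr
        _ ≤ _ := by rw [mul_one]; exact le_self_add
    · have hmem {u : ℝ} : ‖u‖ₑ < 1 ↔ u ∈ Metric.ball (0 : ℝ) 1 := by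
        rw [mem_ball_zero_iff, ← ofReal_norm, ENNReal.ofReal_lt_one]
      calc gammaPDF a 1 x * ‖x + t‖ₑ ^ (-s) ≤ D * ‖x‖ₑ ^ (-(1 - b)) * ‖x + t‖ₑ ^ (-s) := by
            gcongr
            exact hpdf x hx
        _ = D * (‖x‖ₑ ^ (-(1 - b)) * ‖x + t‖ₑ ^ (-s)) := mul_assoc _ _ _
        _ ≤ D * (h x + h (x + t)) := by
            gcongr
            have ht : h (x + t) = ‖x + t‖ₑ ^ (-α) := Set.indicator_of_mem (hmem.mp h1) _
            -- Away from the origin the density factor is at most `1`, and `s ≤ α` with base below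
            -- `1` lets `α` replace `s`.
            rcases le_or_gt 1 ‖x‖ₑ with h2 | h2
            · calc ‖x‖ₑ ^ (-(1 - b)) * ‖x + t‖ₑ ^ (-s) ≤ 1 * ‖x + t‖ₑ ^ (-α) := by
                    exact mul_le_mul' (ENNReal.rpow_neg_le_one_of_one_le h2 (by linarith))
                      (ENNReal.rpow_le_rpow_of_exponent_ge h1.le (by linarith))
                _ ≤ h x + h (x + t) := by rw [one_mul, ht]; exact le_add_self
            · have hx' : h x = ‖x‖ₑ ^ (-α) := Set.indicator_of_mem (hmem.mp h2) _
              rw [ht, hx']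
              exact ENNReal.rpow_neg_mul_rpow_neg_le _ _ (by linarith) hs
        _ ≤ _ := le_add_self
  have hpm : Measurable (gammaPDF a 1) := (measurable_gammaPDFReal a 1).ennreal_ofReal
  rw [gammaMeasure, lintegral_withDensity_eq_lintegral_mul _ hpm (by fun_prop)]
  calc ∫⁻ x, (gammaPDF a 1 * fun x => ‖x + t‖ₑ ^ (-s)) x
    _ ≤ ∫⁻ x, (gammaPDF a 1 x + D * (h x + h (x + t))) := by
        refine lintegral_mono_ae ?_
        filter_upwards [Measure.ae_ne volume (0 : ℝ)] with x hx
        exact hpt x hx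
    _ = 1 + D * (I + I) := by
        rw [lintegral_add_left hpm, lintegral_gammaPDF_eq_one ha one_pos, lintegral_const_mul _
          (by fun_prop), lintegral_add_left hhm, lintegral_add_right_eq_self h t, hhI]

theorem lintegral_enorm_rpow_gammaMeasure {a s : ℝ} (ha : 0 < a) (hs : 0 ≤ s) :
    ∫⁻ x, ‖x‖ₑ ^ s ∂(gammaMeasure a 1) = ENNReal.ofReal (Real.Gamma (a + s) / Real.Gamma a) := by
  have hpm (a : ℝ) : Measurable (gammaPDF a 1) := (measurable_gammaPDFReal a 1).ennreal_ofReal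
  have h1 := Real.Gamma_pos_of_pos ha
  have h2 := Real.Gamma_pos_of_pos (show 0 < a + s by positivity)
  rw [gammaMeasure, lintegral_withDensity_eq_lintegral_mul _ (hpm a) (by fun_prop)]
  calc ∫⁻ x, (gammaPDF a 1 * fun x : ℝ => ‖x‖ₑ ^ s) x
    _ = ∫⁻ x, ENNReal.ofReal (Real.Gamma (a + s) / Real.Gamma a) * gammaPDF (a + s) 1 x := by
        refine lintegral_congr_ae ?_
        filter_upwards [Measure.ae_ne volume (0 : ℝ)] with x hx
        rcases hx.lt_or_gt with hx | hx
        · simp [gammaPDF_of_neg hx]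
        simp only [Pi.mul_apply]
        rw [gammaPDF_of_nonneg hx.le, gammaPDF_of_nonneg hx.le, Real.enorm_of_nonneg hx.le,
          ENNReal.ofReal_rpow_of_pos hx, ← ENNReal.ofReal_mul (by positivity),
          ← ENNReal.ofReal_mul (by positivity)]
        congr 1
        rw [show a + s - 1 = (a - 1) + s by ring, Real.rpow_add hx, Real.one_rpow, Real.one_rpow]
        field_simp
    _ = _ := by
        rw [lintegral_const_mul _ (hpm _), lintegral_gammaPDF_eq_one (by positivity) one_pos,
          mul_one]

theorem gammaMeasure_ae_pos (a : ℝ) : ∀ᵐ x ∂(gammaMeasure a 1), 0 < x := by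
  have hpm : Measurable (gammaPDF a 1) := (measurable_gammaPDFReal a 1).ennreal_ofReal
  rw [gammaMeasure, ae_withDensity_iff hpm]
  filter_upwards [Measure.ae_ne volume (0 : ℝ)] with x hx h
  by_contra hx'
  exact h (gammaPDF_of_neg (lt_of_le_of_ne (not_lt.mp hx') hx))

theorem ENNReal.sum_rpow_le {ι : Type*} (t : Finset ι) (f : ι → ℝ≥0∞) {s : ℝ} (hs : 0 < s)
    (hs1 : s ≤ 1) : (∑ i ∈ t, f i) ^ s ≤ ∑ i ∈ t, f i ^ s := by
  classical
  induction t using Finset.induction_on with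
  | empty => simp [hs]
  | insert i t hi ih =>
    rw [Finset.sum_insert hi, Finset.sum_insert hi]
    exact (ENNReal.rpow_add_le_add_rpow _ _ hs.le hs1).trans (by gcongr)

/-! ### Moments of the logarithm of the random sum -/

/-- Since `(w + z) / (w - z) = 1 + 2z / (w - z)` and `z` is bounded, only the locally integrable `|w
- z|^(-s)` matters, uniformly in `w`. -/
theorem exists_setLIntegral_enorm_add_div_sub_rpow_le {s : ℝ} (hs : 0 < s) (hs1 : s ≤ 1) (R : ℝ) :
    ∃ C : ℝ≥0∞, C ≠ ∞ ∧ ∀ w : ℂ,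
      ∫⁻ z in Metric.ball 0 R, ‖(w + z) / (w - z)‖ₑ ^ s ≤ C ∧
      ∫⁻ z in Metric.ball 0 R, ‖(w + z) / (w - z)‖ₑ ^ (-s) ≤ C := by
  set I := ∫⁻ z : ℂ in Metric.ball 0 1, ‖z‖ₑ ^ (-s)
  have hI : I < ∞ := setLIntegral_ball_enorm_rpow_neg_lt_top volume
    (by rw [Complex.finrank_real_complex]; push_cast; linarith) 1
  set B := volume (Metric.ball (0 : ℂ) R)
  have hB : B < ∞ := measure_ball_lt_top
  have hloc (w : ℂ) : ∫⁻ z in Metric.ball 0 R, ‖w - z‖ₑ ^ (-s) ≤ I + B := by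
    have hpt (z : ℂ) : ‖w - z‖ₑ ^ (-s) ≤
        (Metric.ball (0 : ℂ) 1).indicator (fun u => ‖u‖ₑ ^ (-s)) (w - z) + 1 := by
      by_cases h : w - z ∈ Metric.ball (0 : ℂ) 1
      · rw [Set.indicator_of_mem h]
        exact le_self_add
      · refine le_trans ?_ le_add_self
        rw [mem_ball_zero_iff, not_lt] at h
        refine ENNReal.rpow_neg_le_one_of_one_le ?_ hs.le
        rw [← ofReal_norm, ENNReal.one_le_ofReal]
        exact h
    calc _ ≤ ∫⁻ z in Metric.ball 0 R, ((Metric.ball (0 : ℂ) 1).indicator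
            (fun u => ‖u‖ₑ ^ (-s)) (w - z) + 1) := lintegral_mono hpt
      _ = (∫⁻ z in Metric.ball 0 R, (Metric.ball (0 : ℂ) 1).indicator
            (fun u => ‖u‖ₑ ^ (-s)) (w - z)) + B := by
          rw [lintegral_add_right _ measurable_const, lintegral_const, one_mul,
            Measure.restrict_apply_univ]
      _ ≤ (∫⁻ z, (Metric.ball (0 : ℂ) 1).indicator (fun u => ‖u‖ₑ ^ (-s)) (w - z)) + B := by
          gcongr
          exact Measure.restrict_le_self
      _ = I + B := by
          rw [lintegral_sub_left_eq_self (μ := (volume : Measure ℂ))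
            ((Metric.ball (0 : ℂ) 1).indicator (fun u => ‖u‖ₑ ^ (-s))) w,
            lintegral_indicator Metric.isOpen_ball.measurableSet]
  set C := B + ENNReal.ofReal (2 * R) ^ s * (I + B) with hC
  have hup (w : ℂ) : ∫⁻ z in Metric.ball 0 R, ‖(w + z) / (w - z)‖ₑ ^ s ≤ C := by
    calc ∫⁻ z in Metric.ball 0 R, ‖(w + z) / (w - z)‖ₑ ^ s
      _ ≤ ∫⁻ z in Metric.ball 0 R, (1 + ENNReal.ofReal (2 * R) ^ s * ‖w - z‖ₑ ^ (-s)) := by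
          refine lintegral_mono_ae ?_
          filter_upwards [ae_restrict_of_ae (Measure.ae_ne volume w),
            ae_restrict_mem Metric.isOpen_ball.measurableSet] with z hz hzR
          have hwz : w - z ≠ 0 := sub_ne_zero.mpr hz.symm
          have e : (w + z) / (w - z) = 1 + 2 * z / (w - z) := by
            field_simp
            ring
          calc ‖(w + z) / (w - z)‖ₑ ^ s ≤ (1 + ENNReal.ofReal (2 * R) * ‖w - z‖ₑ⁻¹) ^ s := by
                gcongr
                rw [e]
                refine (enorm_add_le _ _).trans ?_
                rw [enorm_one, div_eq_mul_inv, enorm_mul, enorm_inv hwz]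
                gcongr
                rw [← ofReal_norm]
                refine ENNReal.ofReal_le_ofReal ?_
                rw [mem_ball_zero_iff] at hzR
                rw [norm_mul, Complex.norm_ofNat]
                linarith
            _ ≤ 1 ^ s + (ENNReal.ofReal (2 * R) * ‖w - z‖ₑ⁻¹) ^ s :=
                ENNReal.rpow_add_le_add_rpow _ _ hs.le hs1
            _ = _ := by
                rw [ENNReal.one_rpow, ENNReal.mul_rpow_of_nonneg _ _ hs.le, ENNReal.inv_rpow,
                  ENNReal.rpow_neg]
      _ ≤ C := by
          rw [lintegral_add_left measurable_const, lintegral_const, one_mul,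
            Measure.restrict_apply_univ, lintegral_const_mul _ (by fun_prop), hC]
          gcongr
          exact hloc w
  refine ⟨C, by finiteness, fun w => ⟨hup w, le_trans (le_of_eq ?_) (hup w)⟩⟩
  -- The reflection `z ↦ -z` inverts the quotient and preserves the disc, so the negative power has
  -- the same integral as the positive one.
  have hneg : MeasurePreserving (fun z : ℂ => -z) := Measure.measurePreserving_neg volume
  have hpre : (fun z : ℂ => -z) ⁻¹' Metric.ball 0 R = Metric.ball 0 R := by
    ext z
    simp
  have hsub := hneg.setLIntegral_comp_preimage (f := fun z => ‖(w + z) / (w - z)‖ₑ ^ s)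
    (Metric.isOpen_ball (x := (0 : ℂ)) (ε := R)).measurableSet (by fun_prop)
  rw [hpre] at hsub
  rw [← hsub]
  refine lintegral_congr_ae ?_
  filter_upwards [ae_restrict_of_ae (Measure.ae_ne volume w),
    ae_restrict_of_ae (Measure.ae_ne volume (-w))] with z hz hz'
  have h1 : w - z ≠ 0 := sub_ne_zero.mpr hz.symm
  have h2 : w + z ≠ 0 := fun h => hz' (by linear_combination h)
  rw [ENNReal.rpow_neg, ← ENNReal.inv_rpow, ← enorm_inv (div_ne_zero h2 h1), inv_div,
    ← sub_eq_add_neg, sub_neg_eq_add]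

theorem enorm_log_rpow_three_le (x : ℂ) {s : ℝ} (hs : 0 < s) :
    ‖Real.log ‖x‖‖ₑ ^ (3 : ℝ) ≤
      ENNReal.ofReal ((3 / s) ^ (3 : ℝ)) * (‖x‖ₑ ^ s + ‖x‖ₑ ^ (-s)) := by
  rcases eq_or_ne x 0 with rfl | hx
  -- At `x = 0` the left side vanishes because `Real.log 0 = 0`.
  · simp
  have hx0 : 0 < ‖x‖ := norm_pos_iff.mpr hx
  have key {y : ℝ} (hy : 1 ≤ y) : |Real.log y| ^ (3 : ℝ) ≤ (3 / s) ^ (3 : ℝ) * y ^ s := by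
    have h0 : 0 ≤ y := zero_le_one.trans hy
    rw [abs_of_nonneg (Real.log_nonneg hy)]
    calc Real.log y ^ (3 : ℝ) ≤ (y ^ (s / 3) / (s / 3)) ^ (3 : ℝ) :=
          Real.rpow_le_rpow (Real.log_nonneg hy) (Real.log_le_rpow_div h0 (by positivity))
            (by norm_num)
      _ = _ := by
          rw [div_eq_mul_inv, inv_div, Real.mul_rpow (by positivity) (by positivity),
            ← Real.rpow_mul h0, div_mul_cancel₀ _ (by norm_num), mul_comm]
  rw [← ofReal_norm x, ENNReal.ofReal_rpow_of_pos hx0, ENNReal.ofReal_rpow_of_pos hx0,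
    ← ENNReal.ofReal_add (by positivity) (by positivity), ← ENNReal.ofReal_mul (by positivity),
    ← ofReal_norm (Real.log _), ENNReal.ofReal_rpow_of_nonneg (by positivity) (by norm_num),
    Real.norm_eq_abs]
  refine ENNReal.ofReal_le_ofReal ?_
  rw [mul_add]
  rcases le_total 1 ‖x‖ with h | h
  · exact (key h).trans (le_add_of_nonneg_right (by positivity))
  · have := key (one_le_inv_iff₀.mpr ⟨hx0, h⟩)
    rw [Real.log_inv, abs_neg, Real.inv_rpow hx0.le, ← Real.rpow_neg hx0.le] at this
    exact this.trans (le_add_of_nonneg_left (by positivity))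

theorem lintegral_pi_enorm_sum_rpow_le {n : ℕ} (ρ : Measure ℝ) [IsProbabilityMeasure ρ]
    (c : Fin n → ℂ) {s : ℝ} (hs : 0 < s) (hs1 : s ≤ 1) :
    ∫⁻ g, ‖∑ k, c k * (g k : ℂ)‖ₑ ^ s ∂(Measure.pi fun _ : Fin n => ρ) ≤
      ∑ k, ‖c k‖ₑ ^ s * ∫⁻ x, ‖x‖ₑ ^ s ∂ρ := by
  calc ∫⁻ g, ‖∑ k, c k * (g k : ℂ)‖ₑ ^ s ∂(Measure.pi fun _ : Fin n => ρ)
    _ ≤ ∫⁻ g, ∑ k, ‖c k‖ₑ ^ s * ‖g k‖ₑ ^ s ∂(Measure.pi fun _ : Fin n => ρ) := by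
        refine lintegral_mono fun g => ?_
        calc _ ≤ (∑ k, ‖c k * (g k : ℂ)‖ₑ) ^ s := by
              gcongr
              exact enorm_sum_le _ _
          _ ≤ ∑ k, ‖c k * (g k : ℂ)‖ₑ ^ s := ENNReal.sum_rpow_le _ _ hs hs1
          _ = _ := by
              refine Finset.sum_congr rfl fun k _ => ?_
              rw [enorm_mul, ENNReal.mul_rpow_of_nonneg _ _ hs.le, ← ofReal_norm (g k : ℂ),
                Complex.norm_real, ofReal_norm]
    _ = _ := by
        rw [lintegral_finsetSum _ fun k _ => by fun_prop]
        refine Finset.sum_congr rfl fun k _ => ?_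
        rw [lintegral_const_mul _ (by fun_prop)]
        congr 1
        exact (measurePreserving_eval (fun _ : Fin n => ρ) k).lintegral_comp
          (f := fun x => ‖x‖ₑ ^ s) (by fun_prop)

/-- Factor out `c` and bound the modulus below by the real part: the variable is real, so a complex
shift reduces to a real one. -/
theorem lintegral_enorm_mul_add_rpow_neg_le {ρ : Measure ℝ} {s : ℝ} (hs : 0 < s) {C : ℝ≥0∞}
    (hC : ∀ t : ℝ, ∫⁻ x, ‖x + t‖ₑ ^ (-s) ∂ρ ≤ C) {c : ℂ} (hc : c ≠ 0) (b : ℂ) :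
    ∫⁻ x, ‖c * (x : ℂ) + b‖ₑ ^ (-s) ∂ρ ≤ ‖c‖ₑ ^ (-s) * C := by
  calc ∫⁻ x, ‖c * (x : ℂ) + b‖ₑ ^ (-s) ∂ρ ≤ ∫⁻ x, ‖c‖ₑ ^ (-s) * ‖x + (b / c).re‖ₑ ^ (-s) ∂ρ := by
        refine lintegral_mono fun x => ?_
        have e : c * (x : ℂ) + b = c * (x + b / c) := by field_simp
        have hre : ‖x + (b / c).re‖ₑ ≤ ‖(x : ℂ) + b / c‖ₑ := by
          rw [← ofReal_norm, ← ofReal_norm]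
          refine ENNReal.ofReal_le_ofReal ?_
          have := Complex.abs_re_le_norm ((x : ℂ) + b / c)
          simpa using this
        have hcn : ‖c‖ₑ ≠ 0 := by simpa using hc
        rw [e, enorm_mul, ENNReal.rpow_neg, ENNReal.rpow_neg, ENNReal.rpow_neg,
          ENNReal.mul_rpow_of_nonneg _ _ hs.le, ENNReal.mul_inv]
        · gcongr
        · left
          simp [hs, hc]
        · left
          finiteness
    _ ≤ _ := by
        rw [lintegral_const_mul _ (by fun_prop)]
        gcongr
        exact hC _

theorem lintegral_pi_fin_succ {n : ℕ} (ρ : Measure ℝ) [IsProbabilityMeasure ρ]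
    {h : ℝ × (Fin n → ℝ) → ℝ≥0∞} (hm : Measurable h) :
    ∫⁻ g : Fin (n + 1) → ℝ, h (g 0, fun k => g k.succ) ∂(Measure.pi fun _ => ρ) =
      ∫⁻ g, ∫⁻ x, h (x, g) ∂ρ ∂(Measure.pi fun _ : Fin n => ρ) := by
  have := (measurePreserving_piFinSuccAbove (fun _ : Fin (n + 1) => ρ) 0).lintegral_comp hm
  rw [lintegral_prod_symm' _ hm] at this
  exact this

/-- Conditionally on the other coordinates, the sum is an affine function of the first one; the
bound ignores the shift and so does not grow with `n`. -/
theorem lintegral_pi_enorm_sum_rpow_neg_le {n : ℕ} (ρ : Measure ℝ) [IsProbabilityMeasure ρ]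
    {c : Fin (n + 1) → ℂ} (hc : c 0 ≠ 0) {s : ℝ} (hs : 0 < s) {C : ℝ≥0∞}
    (hC : ∀ t : ℝ, ∫⁻ x, ‖x + t‖ₑ ^ (-s) ∂ρ ≤ C) :
    ∫⁻ g, ‖∑ k, c k * (g k : ℂ)‖ₑ ^ (-s) ∂(Measure.pi fun _ : Fin (n + 1) => ρ) ≤
      ‖c 0‖ₑ ^ (-s) * C := by
  simp_rw [Fin.sum_univ_succ]
  rw [lintegral_pi_fin_succ ρ (h := fun x =>
    ‖c 0 * (x.1 : ℂ) + ∑ k, c (Fin.succ k) * (x.2 k : ℂ)‖ₑ ^ (-s)) (by fun_prop)]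
  have hle (g : Fin n → ℝ) : ∫⁻ x, ‖c 0 * (x : ℂ) + ∑ k, c (Fin.succ k) * (g k : ℂ)‖ₑ ^ (-s) ∂ρ ≤
      ‖c 0‖ₑ ^ (-s) * C := lintegral_enorm_mul_add_rpow_neg_le hs hC hc _
  refine (lintegral_mono hle).trans ?_
  rw [lintegral_const, measure_univ, mul_one]

/-- The third moment of the logarithm of a randomized sum `∑ γ_k (Z_k + z) / (Z_k - z)`, averaged
over a disc of points `z`, is at most linear in the number of terms, uniformly in the `Z_k`. -/
theorem exists_lintegral_log_enorm_sum_rpow_three_le {a : ℝ} (ha : 0 < a) (R : ℝ) :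
    ∃ K : ℝ≥0∞, K ≠ ∞ ∧ ∀ n > 0, ∀ Z : Fin n → ℂ,
      ∫⁻ g, (∫⁻ z in Metric.ball 0 R,
        ‖Real.log ‖∑ k, (Z k + z) / (Z k - z) * (g k : ℂ)‖‖ₑ ^ (3 : ℝ))
        ∂(Measure.pi fun _ : Fin n => gammaMeasure a 1) ≤ n * K := by
  have hprob := isProbabilityMeasure_gammaMeasure ha one_pos
  -- Negative gamma moments require `s < a` and `s < 1`; subadditivity requires `s ≤ 1`.
  set s := min a 1 / 2 with hs_def
  have hmin : 0 < min a 1 := lt_min ha one_pos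
  have hs : 0 < s := by positivity
  have hsa : s < a := by linarith [min_le_left a 1]
  have hs1 : s < 1 := by linarith [min_le_right a 1]
  obtain ⟨C, hC, hCle⟩ := exists_lintegral_enorm_add_rpow_neg_gammaMeasure_le hs.le hsa hs1
  obtain ⟨B, hB, hBle⟩ := exists_setLIntegral_enorm_add_div_sub_rpow_le hs hs1.le R
  set G := ∫⁻ x, ‖x‖ₑ ^ s ∂(gammaMeasure a 1) with hG
  have hGlt : G ≠ ∞ := by
    rw [hG, lintegral_enorm_rpow_gammaMeasure ha hs.le]
    exact ENNReal.ofReal_ne_top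
  set D := ENNReal.ofReal ((3 / s) ^ (3 : ℝ)) with hD_def
  have hD : D ≠ ∞ := ENNReal.ofReal_ne_top
  refine ⟨D * (B * G + B * C), by finiteness, fun n hn Z => ?_⟩
  obtain ⟨m, rfl⟩ : ∃ m, n = m + 1 := ⟨n - 1, by omega⟩
  set ν := Measure.pi fun _ : Fin (m + 1) => gammaMeasure a 1
  have hpt : ∀ᵐ z : ℂ, ∫⁻ g, ‖Real.log ‖∑ k, (Z k + z) / (Z k - z) * (g k : ℂ)‖‖ₑ ^ (3 : ℝ) ∂ν ≤
      D * ((∑ k, ‖(Z k + z) / (Z k - z)‖ₑ ^ s * G) + ‖(Z 0 + z) / (Z 0 - z)‖ₑ ^ (-s) * C) := by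
    filter_upwards [Measure.ae_ne volume (Z 0), Measure.ae_ne volume (-Z 0)] with z h1 h2
    have hc : (Z 0 + z) / (Z 0 - z) ≠ 0 :=
      div_ne_zero (fun h => h2 (by linear_combination h)) (sub_ne_zero.mpr h1.symm)
    calc _ ≤ ∫⁻ g, D * (‖∑ k, (Z k + z) / (Z k - z) * (g k : ℂ)‖ₑ ^ s +
          ‖∑ k, (Z k + z) / (Z k - z) * (g k : ℂ)‖ₑ ^ (-s)) ∂ν :=
          lintegral_mono fun g => enorm_log_rpow_three_le _ hs
      _ = D * (∫⁻ g, ‖∑ k, (Z k + z) / (Z k - z) * (g k : ℂ)‖ₑ ^ s ∂ν +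
          ∫⁻ g, ‖∑ k, (Z k + z) / (Z k - z) * (g k : ℂ)‖ₑ ^ (-s) ∂ν) := by
          rw [lintegral_const_mul _ (by fun_prop), lintegral_add_left (by fun_prop)]
      _ ≤ _ := by
          gcongr
          · exact lintegral_pi_enorm_sum_rpow_le _ _ hs hs1.le
          · exact lintegral_pi_enorm_sum_rpow_neg_le _
              (c := fun k => (Z k + z) / (Z k - z)) hc hs hCle
  calc ∫⁻ g, (∫⁻ z in Metric.ball 0 R,
        ‖Real.log ‖∑ k, (Z k + z) / (Z k - z) * (g k : ℂ)‖‖ₑ ^ (3 : ℝ)) ∂ν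
    _ = ∫⁻ z in Metric.ball 0 R, ∫⁻ g,
        ‖Real.log ‖∑ k, (Z k + z) / (Z k - z) * (g k : ℂ)‖‖ₑ ^ (3 : ℝ) ∂ν := by
        refine lintegral_lintegral_swap ?_
        have : Measurable (Function.uncurry fun (g : Fin (m + 1) → ℝ) (z : ℂ) =>
            ‖Real.log ‖∑ k, (Z k + z) / (Z k - z) * (g k : ℂ)‖‖ₑ ^ (3 : ℝ)) := by
          unfold Function.uncurry
          fun_prop
        exact this.aemeasurable
    _ ≤ ∫⁻ z in Metric.ball 0 R, D * ((∑ k, ‖(Z k + z) / (Z k - z)‖ₑ ^ s * G) +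
        ‖(Z 0 + z) / (Z 0 - z)‖ₑ ^ (-s) * C) := lintegral_mono_ae (ae_restrict_of_ae hpt)
    _ = D * ((∑ k, (∫⁻ z in Metric.ball 0 R, ‖(Z k + z) / (Z k - z)‖ₑ ^ s) * G) +
        (∫⁻ z in Metric.ball 0 R, ‖(Z 0 + z) / (Z 0 - z)‖ₑ ^ (-s)) * C) := by
        rw [lintegral_const_mul _ (by fun_prop), lintegral_add_left (by fun_prop),
          lintegral_finsetSum _ fun k _ => by fun_prop, lintegral_mul_const _ (by fun_prop)]
        congr 3 with k
        rw [lintegral_mul_const _ (by fun_prop)]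
    _ ≤ D * ((∑ _k : Fin (m + 1), B * G) + B * C) := by
        gcongr with k
        · exact (hBle (Z k)).1
        · exact (hBle (Z 0)).2
    _ ≤ _ := by
        -- The single negative-moment term is absorbed into the factor `m + 1 ≥ 1`.
        rw [Finset.sum_const, Finset.card_univ, Fintype.card_fin, nsmul_eq_mul,
          mul_left_comm ((m + 1 : ℕ) : ℝ≥0∞) D, mul_add ((m + 1 : ℕ) : ℝ≥0∞)]
        refine mul_le_mul' le_rfl (add_le_add le_rfl (le_mul_of_one_le_left zero_le ?_))
        exact_mod_cast Nat.le_add_left 1 m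

/-! ### Almost sure convergence and conclusion -/

theorem lintegral_le_lintegral_rpow_three_rpow {α : Type*} [MeasurableSpace α] (μ : Measure α) {f : α → ℝ≥0∞}
    (hf : AEMeasurable f μ) :
    ∫⁻ x, f x ∂μ ≤ (∫⁻ x, f x ^ (3 : ℝ) ∂μ) ^ (1 / 3 : ℝ) * μ Set.univ ^ (2 / 3 : ℝ) := by
  have hpq : (3 : ℝ).HolderConjugate (3 / 2) := by
    rw [Real.holderConjugate_iff]
    norm_num
  have := ENNReal.lintegral_mul_le_Lp_mul_Lq μ hpq hf (aemeasurable_const (b := 1))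
  simpa using this

/-- The cubed logarithm has disc integral of mean `O(n)`; with weight `n⁻³` the means are `O(n⁻²)`,
hence summable, so almost surely the weighted integrals tend to `0`. Hölder then passes to the first
power. With squares in place of cubes this bound would give only a harmonic series. -/
theorem ae_tendsto_inv_mul_lintegral_log {Ω : Type*} [MeasurableSpace Ω] {P : Measure Ω}
    [IsProbabilityMeasure P] {a : ℝ} (ha : 0 < a)
    {Z : (n : ℕ) → Fin n → Ω → ℂ} (hZ : ∀ n k, Measurable (Z n k))
    {γ : (n : ℕ) → Fin n → Ω → ℝ} (hγ_law : ∀ n k, HasLaw (γ n k) (gammaMeasure a 1) P)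
    (hγ_indep : ∀ n, iIndepFun (γ n) P)
    (hZγ : ∀ n, IndepFun (fun ω k => Z n k ω) (fun ω k => γ n k ω) P) (R : ℝ) :
    ∀ᵐ ω ∂P, Tendsto (fun n : ℕ => (n : ℝ≥0∞)⁻¹ * ∫⁻ z in Metric.ball 0 R,
      ‖Real.log ‖∑ k, (Z n k ω + z) / (Z n k ω - z) * (γ n k ω : ℂ)‖‖ₑ) atTop (𝓝 0) := by
  have hprob := isProbabilityMeasure_gammaMeasure ha one_pos
  obtain ⟨K, hK, hKle⟩ := exists_lintegral_log_enorm_sum_rpow_three_le ha R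
  set F : (n : ℕ) → (Fin n → ℂ) × (Fin n → ℝ) → ℝ≥0∞ := fun n x =>
    ∫⁻ z in Metric.ball 0 R,
      ‖Real.log ‖∑ k, (x.1 k + z) / (x.1 k - z) * (x.2 k : ℂ)‖‖ₑ ^ (3 : ℝ)
  have hF (n) : Measurable (F n) := by
    refine Measurable.lintegral_prod_right' (f := fun y : ((Fin n → ℂ) × (Fin n → ℝ)) × ℂ =>
      ‖Real.log ‖∑ k, (y.1.1 k + y.2) / (y.1.1 k - y.2) * (y.1.2 k : ℂ)‖‖ₑ ^ (3 : ℝ)) ?_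
    fun_prop
  have hZm (n) : Measurable fun ω k => Z n k ω := measurable_pi_lambda _ fun k => hZ n k
  have hlaw (n) : HasLaw (fun ω => ((fun k => Z n k ω), fun k => γ n k ω))
      ((P.map fun ω k => Z n k ω).prod (Measure.pi fun _ => gammaMeasure a 1)) P :=
    IndepFun.hasLaw_prod ⟨(hZm n).aemeasurable, rfl⟩ ((hγ_indep n).hasLaw_pi (hγ_law n)) (hZγ n)
  have hmean (n : ℕ) (hn : 0 < n) :
      ∫⁻ ω, F n ((fun k => Z n k ω), fun k => γ n k ω) ∂P ≤ n * K := by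
    have := Measure.isProbabilityMeasure_map (μ := P) (hZm n).aemeasurable
    rw [(hlaw n).lintegral_comp (hF n).aemeasurable, lintegral_prod _ (hF n).aemeasurable]
    calc _ ≤ ∫⁻ _, n * K ∂(P.map fun ω k => Z n k ω) := lintegral_mono fun ζ => hKle n hn ζ
      _ = n * K := by simp
  have hFm (n) : AEMeasurable (fun ω => F n ((fun k => Z n k ω), fun k => γ n k ω)) P :=
    (hF n).comp_aemeasurable (hlaw n).aemeasurable
  have hsum : ∑' n : ℕ, ∫⁻ ω, ((n : ℝ≥0∞) ^ 3)⁻¹ * F n ((fun k => Z n k ω), fun k => γ n k ω) ∂P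
      ≠ ∞ := by
    have hsq : ∑' n : ℕ, ENNReal.ofReal (((n : ℝ) ^ 2)⁻¹) ≠ ∞ := by
      rw [← ENNReal.ofReal_tsum_of_nonneg (fun n => by positivity)
        (Real.summable_nat_pow_inv.mpr one_lt_two)]
      exact ENNReal.ofReal_ne_top
    refine ne_top_of_le_ne_top (ENNReal.mul_ne_top hK hsq) ?_
    rw [← ENNReal.tsum_mul_left]
    refine ENNReal.tsum_le_tsum fun n => ?_
    rcases n.eq_zero_or_pos with rfl | hn
    -- For `n = 0` the weight is `∞`, but the empty sum gives `log 0 = 0` and the product is `0`.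
    · simp [F]
    have hn0 : (n : ℝ≥0∞) ≠ 0 := by exact_mod_cast hn.ne'
    rw [lintegral_const_mul'' _ (hFm n), ENNReal.ofReal_inv_of_pos (by positivity),
      ENNReal.ofReal_pow (by positivity), ENNReal.ofReal_natCast]
    calc _ ≤ ((n : ℝ≥0∞) ^ 3)⁻¹ * (n * K) := by
          gcongr
          exact hmean n hn
      _ = K * ((n : ℝ≥0∞) ^ 2)⁻¹ * ((n : ℝ≥0∞)⁻¹ * n) := by
          rw [pow_succ, ENNReal.mul_inv (by simp) (by simp)]
          ring
      _ = _ := by rw [ENNReal.inv_mul_cancel hn0 (by simp), mul_one]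
  rw [← lintegral_tsum fun n => (hFm n).const_mul _] at hsum
  filter_upwards [ae_lt_top' (AEMeasurable.tsum fun n =>
    (hFm n).const_mul _) hsum] with ω hω
  have h0 := ENNReal.tendsto_atTop_zero_of_tsum_ne_top hω.ne
  have h1 : Tendsto (fun n : ℕ => (((n : ℝ≥0∞) ^ 3)⁻¹ *
      F n ((fun k => Z n k ω), fun k => γ n k ω)) ^ (1 / 3 : ℝ) *
      volume (Metric.ball (0 : ℂ) R) ^ (2 / 3 : ℝ)) atTop (𝓝 0) := by
    have h2 := h0.ennrpow_const (1 / 3 : ℝ)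
    have := ENNReal.Tendsto.mul_const (b := volume (Metric.ball (0 : ℂ) R) ^ (2 / 3 : ℝ)) h2
      (Or.inr (by have := measure_ball_lt_top (μ := volume) (x := (0 : ℂ)) (r := R); finiteness))
    simpa using this
  refine tendsto_of_tendsto_of_tendsto_of_le_of_le' tendsto_const_nhds h1
    (Eventually.of_forall fun _ => zero_le) ?_
  filter_upwards [eventually_gt_atTop 0] with n hn
  have hm : AEMeasurable (fun z => ‖Real.log
      ‖∑ k, (Z n k ω + z) / (Z n k ω - z) * (γ n k ω : ℂ)‖‖ₑ)
      (volume.restrict (Metric.ball (0 : ℂ) R)) := by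
    fun_prop
  have := lintegral_le_lintegral_rpow_three_rpow _ hm
  rw [Measure.restrict_apply_univ] at this
  rw [ENNReal.mul_rpow_of_nonneg _ _ (by norm_num), mul_assoc]
  refine (mul_le_mul_right this _).trans (le_of_eq ?_)
  congr 1
  rw [ENNReal.inv_rpow, ← ENNReal.rpow_natCast, ← ENNReal.rpow_mul]
  norm_num

theorem log_norm_eval_circularDerivative_sub_ae {n : ℕ} (Z : Fin n → ℂ) {γ : Fin n → ℝ}
    (hV : circularDerivative Z γ ≠ 0) :
    ∀ᵐ z : ℂ, Real.log ‖(circularDerivative Z γ).eval z‖ -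
      Real.log ‖(zeroPolynomial Z).eval z‖ =
      Real.log ‖∑ k, (Z k + z) / (Z k - z) * (γ k : ℂ)‖ := by
  have h1 : ∀ᵐ z : ℂ, ∀ k, z ≠ Z k := ae_all_iff.mpr fun k => Measure.ae_ne volume (Z k)
  have h2 (p : Polynomial ℂ) (hp : p ≠ 0) : ∀ᵐ z : ℂ, p.eval z ≠ 0 := by
    filter_upwards [p.roots.toFinset.countable_toSet.ae_notMem volume] with z hz h0
    exact hz (by simpa [hp] using h0)
  filter_upwards [h1, h2 _ hV, h2 _ (zeroPolynomial_ne_zero Z)] with z hz hVz hPz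
  rw [circularDerivative_eval Z γ z hz] at hVz ⊢
  rw [norm_mul, Real.log_mul (norm_ne_zero_iff.mpr hPz)
    (norm_ne_zero_iff.mpr (right_ne_zero_of_mul hVz)), add_sub_cancel_left]

theorem theorem4 {Ω : Type*} [MeasurableSpace Ω] (P : Measure Ω) [IsProbabilityMeasure P]
    (β : ℝ) (hβ : 0 < β)
    (Z : (n : ℕ) → Fin n → Ω → ℂ) (hZ : ∀ n k, Measurable (Z n k))
    (γ : (n : ℕ) → Fin n → Ω → ℝ)
    (hγ_law : ∀ n k, HasLaw (γ n k) (gammaMeasure (β / 2) 1) P)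
    (hγ_indep : ∀ n, iIndepFun (γ n) P)
    (hZγ : ∀ n, IndepFun (fun ω k => Z n k ω) (fun ω k => γ n k ω) P)
    (μ : FiniteMeasure ℂ)
    (hμ : ∀ᵐ ω ∂P, Tendsto
      (fun n => empiricalMeasure (Finset.univ.val.map fun k => Z n k ω)) atTop (𝓝 μ)) :
    ∀ᵐ ω ∂P, Tendsto
      (fun n => empiricalMeasure
        (circularDerivative (fun k => Z n k ω) (fun k => γ n k ω)).roots) atTop (𝓝 μ) := by
  -- Integer radii keep the exceptional set null; they dominate every real radius.
  have hlog : ∀ᵐ ω ∂P, ∀ m : ℕ, Tendsto (fun n : ℕ => (n : ℝ≥0∞)⁻¹ *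
      ∫⁻ z in Metric.ball 0 (m : ℝ),
      ‖Real.log ‖∑ k, (Z n k ω + z) / (Z n k ω - z) * (γ n k ω : ℂ)‖‖ₑ) atTop (𝓝 0) :=
    ae_all_iff.mpr fun m =>
      ae_tendsto_inv_mul_lintegral_log (half_pos hβ) hZ hγ_law hγ_indep hZγ m
  have hpos : ∀ᵐ ω ∂P, ∀ n k, 0 < γ n k ω := by
    refine ae_all_iff.mpr fun n => ae_all_iff.mpr fun k => ?_
    have := gammaMeasure_ae_pos (β / 2)
    rw [← (hγ_law n k).map_eq] at this
    exact ae_of_ae_map (hγ_law n k).aemeasurable this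
  filter_upwards [hμ, hlog, hpos] with ω hω hlogω hposω
  have hsum : ∀ n > 0, ∑ k, γ n k ω ≠ 0 := fun n hn => by
    have : NeZero n := ⟨hn.ne'⟩
    exact (Finset.sum_pos (fun k _ => hposω n k) Finset.univ_nonempty).ne'
  refine tendsto_empiricalMeasure_roots
    (q := fun n => zeroPolynomial fun k => Z n k ω) ?_ ?_ (fun R => ?_) ?_
  · filter_upwards [eventually_gt_atTop 0] with n hn
    exact card_roots_circularDerivative _ (hsum n hn)
  · filter_upwards with n
    rw [roots_zeroPolynomial]
    simp
  · obtain ⟨m, hm⟩ := exists_nat_ge R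
    refine tendsto_of_tendsto_of_tendsto_of_le_of_le' tendsto_const_nhds (hlogω m)
      (Eventually.of_forall fun _ => zero_le) ?_
    filter_upwards [eventually_gt_atTop 0] with n hn
    have hV : circularDerivative (fun k => Z n k ω) (fun k => γ n k ω) ≠ 0 := by
      intro h0
      have := natDegree_circularDerivative (fun k => Z n k ω) (hsum n hn)
      rw [h0, Polynomial.natDegree_zero] at this
      omega
    refine mul_le_mul_right ?_ _
    refine (lintegral_mono_set (Metric.ball_subset_ball hm)).trans (le_of_eq ?_)
    refine lintegral_congr_ae (ae_restrict_of_ae ?_)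
    filter_upwards [log_norm_eval_circularDerivative_sub_ae _ hV] with z hz
    rw [hz]
  · simpa only [roots_zeroPolynomial] using hω
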